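/- For $x\in\mathbb{C}$ and $n\in\mathbb{Z}_{\ge 0}$ let $(x)_n=x(x+1)\cdots(x+n-1)$ (so $(x)_0=1$), and for complex $k$ let $(x)_k=\Gamma(x+k)/\Gamma(x)$, where $1/(x)_k=\Gamma(x)/\Gamma(x+k)$ is read as $0$ when $x+k$ is a pole of $\Gamma$. Then for every $k\in\mathbb{C}\setminus\{-1,-2,-3,\dots\}$ the following series converges absolutely and \[ \sum_{n=0}^{\infty}\left(\frac{-1}{4}\right)^n\frac{\left(\frac12+k\right)_n\left(\frac14+\frac{3k}{2}\right)_n\left(\frac34+\frac{3k}{2}\right)_n}{(1+k)_n^2\,(1)_n}\,(20n+18k+3)=\frac{8}{\pi}\left(\frac{16}{27}\right)^k\frac{(1)_k^2}{\left(\frac16\right)_k\left(\frac56\right)_k}, \] where $(16/27)^k=e^{k\log(16/27)}$ with the real logarithm. In particular ($k=0$), \[ \sum_{n=0}^{\infty}\left(\frac{-1}{4}\right)^n\frac{\left(\frac12\right)_n\left(\frac14\right)_n\left(\frac34\right)_n}{(1)_n^3}\,(20n+3)=\frac{8}{\pi}. \] -/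

import Mathlib

/-- The Pochhammer symbol `(x)_k = Γ(x + k) / Γ(x)` for complex index `k`. At a pole of
`Γ(x + k)` Mathlib's `Complex.Gamma` is `0`, so the reciprocal `1 / (x)_k` takes the value `0`
there, which is the value of the entire function `k ↦ Γ(x) / Γ(x + k)`. -/
noncomputable def pochhammerC (x k : ℂ) : ℂ :=
  Complex.Gamma (x + k) / Complex.Gamma x

/-- For a natural index and `x` not a pole of `Γ`, the quotient of Gamma values is the
rising factorial `x (x + 1) ⋯ (x + n - 1)`. -/
theorem pochhammerC_natCast (x : ℂ) (hx : ∀ m : ℕ, x ≠ -(m : ℂ)) (n : ℕ) :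
    pochhammerC x (n : ℂ) = (ascPochhammer ℂ n).eval x := by
  have hΓ : Complex.Gamma x ≠ 0 := Complex.Gamma_ne_zero hx
  unfold pochhammerC
  rw [div_eq_iff hΓ]
  induction n with
  | zero => simp
  | succ n ih =>
    have h : x + (n : ℂ) ≠ 0 := fun h => hx n (eq_neg_of_add_eq_zero_left h)
    rw [ascPochhammer_succ_eval, Nat.cast_succ, ← add_assoc, Complex.Gamma_add_one _ h, ih]
    ring

/-- The `n`-th term of the series, with rising factorials `(x)_n = x (x + 1) ⋯ (x + n - 1)`. -/
noncomputable def seriesTerm (k : ℂ) (n : ℕ) : ℂ :=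
  (-1 / 4 : ℂ) ^ n *
    ((ascPochhammer ℂ n).eval (1 / 2 + k) *
        (ascPochhammer ℂ n).eval (1 / 4 + 3 * k / 2) *
        (ascPochhammer ℂ n).eval (3 / 4 + 3 * k / 2) /
      ((ascPochhammer ℂ n).eval (1 + k) ^ 2 * (ascPochhammer ℂ n).eval (1 : ℂ))) *
    (20 * (n : ℂ) + 18 * k + 3)

/-! The sum S(k) and the closed form V(k) satisfy the same first-order recursion in k. For S it
comes from a Wilf–Zeilberger pair: `wz_relation` writes a combination of the terms at k + 1 and k as
a difference in n, which telescopes to zero (`tsum_seriesTerm_recursion`). For V it is Γ(x + 1) =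
xΓ(x) (`seriesValue_recursion`). Hence S/V is 1-periodic on Re k > 0. It is holomorphic there and
grows at most like exp(3|Im k|) on 1 ≤ Re k ≤ 2, because S has exponential type at most 3
(`norm_tsum_seriesTerm_le_exp`) and 1/V is bounded on that strip (`exists_norm_Gamma_div_le`). Since
3 < π, a Carlson-type theorem (`eq_zero_of_periodic_of_exponential_type`) forces S/V = 1 once this
holds at k = 1/2, where the series telescopes. The recursion then carries the identity leftwards.
The certificate has a pole at k = -1/2; there the series terminates and is evaluated directly. -/

open Filter Topology

/-! ### Coefficients and the Wilf–Zeilberger pair -/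

/-- The hypergeometric part of `seriesTerm`. -/
noncomputable def seriesCoeff (k : ℂ) (n : ℕ) : ℂ :=
  (-1 / 4 : ℂ) ^ n *
    ((ascPochhammer ℂ n).eval (1 / 2 + k) *
        (ascPochhammer ℂ n).eval (1 / 4 + 3 * k / 2) *
        (ascPochhammer ℂ n).eval (3 / 4 + 3 * k / 2) /
      ((ascPochhammer ℂ n).eval (1 + k) ^ 2 * (ascPochhammer ℂ n).eval (1 : ℂ)))

theorem seriesTerm_eq (k : ℂ) (n : ℕ) :
    seriesTerm k n = seriesCoeff k n * (20 * (n : ℂ) + 18 * k + 3) := rfl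

theorem seriesCoeff_succ (k : ℂ) (n : ℕ) :
    seriesCoeff k (n + 1) = seriesCoeff k n *
      ((-1 / 4) * ((1 / 2 + k + n) * (1 / 4 + 3 * k / 2 + n) * (3 / 4 + 3 * k / 2 + n) /
        ((1 + k + n) ^ 2 * (1 + n)))) := by
  simp only [seriesCoeff, ascPochhammer_succ_eval, pow_succ, div_eq_mul_inv, mul_inv]
  ring

theorem ascPochhammer_eval_ne_zero {x : ℂ} (hx : ∀ m : ℕ, x + m ≠ 0) (n : ℕ) :
    (ascPochhammer ℂ n).eval x ≠ 0 := by
  induction n with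
  | zero => simp
  | succ n ih => rw [ascPochhammer_succ_eval]; exact mul_ne_zero ih (hx n)

theorem ascPochhammer_eval_shift (x : ℂ) (n : ℕ) :
    x * (ascPochhammer ℂ n).eval (x + 1) = (ascPochhammer ℂ n).eval x * (x + n) := by
  rw [← ascPochhammer_succ_eval, ascPochhammer_succ_left]
  simp

/-- Raising k by 1 raises 3k/2 by 3/2, so 1/4 + 3k/2 becomes (3/4 + 3k/2) + 1 and 3/4 + 3k/2 becomes
(1/4 + 3k/2) + 2: the two parameters swap up to integer shifts. The statement is multiplied out so
that no factor on the left need be nonzero. -/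
theorem seriesCoeff_shift {k : ℂ} (hk : ∀ m : ℕ, k ≠ -((m : ℂ) + 1)) (n : ℕ) :
    27 / 16 * (1 / 6 + k) * (5 / 6 + k) * (1 / 2 + k) ^ 2 * seriesCoeff (k + 1) n =
      1 / 2 * (1 / 4 + 3 * k / 2 + n) * (3 / 4 + 3 * k / 2 + n) * (5 / 4 + 3 * k / 2 + n) *
        (1 / 2 + k + n) * ((1 + k) ^ 2 / (1 + k + n) ^ 2) * seriesCoeff k n := by
  have hne : ∀ m : ℕ, 1 + k + m ≠ 0 := fun m h => hk m (by linear_combination h)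
  have h1k : 1 + k ≠ 0 := by simpa using hne 0
  have eA := ascPochhammer_eval_shift (1 / 2 + k) n
  have eB := ascPochhammer_eval_shift (3 / 4 + 3 * k / 2) n
  have eC := ascPochhammer_eval_shift (1 / 4 + 3 * k / 2) n
  have eD := ascPochhammer_eval_shift (1 / 4 + 3 * k / 2 + 1) n
  have eQ := ascPochhammer_eval_shift (1 + k) n
  have eQ' : (ascPochhammer ℂ n).eval (1 + k + 1) =
      (ascPochhammer ℂ n).eval (1 + k) * (1 + k + n) / (1 + k) := by
    rw [eq_div_iff h1k, ← eQ]; ring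
  unfold seriesCoeff
  rw [show 1 / 2 + (k + 1) = 1 / 2 + k + 1 by ring,
    show 1 / 4 + 3 * (k + 1) / 2 = 3 / 4 + 3 * k / 2 + 1 by ring,
    show 3 / 4 + 3 * (k + 1) / 2 = 1 / 4 + 3 * k / 2 + 1 + 1 by ring,
    show 1 + (k + 1) = 1 + k + 1 by ring, eQ']
  have hn := hne n
  set A := (ascPochhammer ℂ n).eval (1 / 2 + k)
  set A' := (ascPochhammer ℂ n).eval (1 / 2 + k + 1)
  set B := (ascPochhammer ℂ n).eval (3 / 4 + 3 * k / 2)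
  set B' := (ascPochhammer ℂ n).eval (3 / 4 + 3 * k / 2 + 1)
  set C := (ascPochhammer ℂ n).eval (1 / 4 + 3 * k / 2)
  set C' := (ascPochhammer ℂ n).eval (1 / 4 + 3 * k / 2 + 1)
  set C'' := (ascPochhammer ℂ n).eval (1 / 4 + 3 * k / 2 + 1 + 1)
  set Q := (ascPochhammer ℂ n).eval (1 + k)
  set E := (ascPochhammer ℂ n).eval (1 : ℂ)
  set X := (-1 / 4 : ℂ) ^ n
  have key : 27 / 16 * (1 / 6 + k) * (5 / 6 + k) * (1 / 2 + k) ^ 2 * (A' * B' * C'') =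
      1 / 2 * (1 / 4 + 3 * k / 2 + n) * (3 / 4 + 3 * k / 2 + n) * (5 / 4 + 3 * k / 2 + n) *
        (1 / 2 + k + n) * (A * C * B) := by
    have e1 : (1 / 4 + 3 * k / 2) * ((1 / 4 + 3 * k / 2 + 1) * C'') =
        C * (1 / 4 + 3 * k / 2 + n) * (1 / 4 + 3 * k / 2 + 1 + n) := by
      rw [eD, ← eC]; ring
    calc _ = 1 / 2 * ((1 / 2 + k) * A') * ((3 / 4 + 3 * k / 2) * B') *
          ((1 / 4 + 3 * k / 2) * ((1 / 4 + 3 * k / 2 + 1) * C'')) := by ring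
      _ = _ := by rw [eA, eB, e1]; ring
  calc _ = X / ((Q * (1 + k + n) / (1 + k)) ^ 2 * E) *
        (27 / 16 * (1 / 6 + k) * (5 / 6 + k) * (1 / 2 + k) ^ 2 * (A' * B' * C'')) := by ring
    _ = _ := by rw [key]; field_simp

/-- The second member of the Wilf–Zeilberger pair. -/
noncomputable def wzMate (k : ℂ) (n : ℕ) : ℂ :=
  seriesCoeff k n * (n * (-8 * (n : ℂ) ^ 2 - (12 + 32 * k) * n - 22 * k ^ 2 - 12 * k - 1 / 2)) *
    ((1 + k) / (1 / 2 + k)) ^ 2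

theorem wz_relation {k : ℂ} (hk : ∀ m : ℕ, k ≠ -((m : ℂ) + 1)) (hk2 : 1 / 2 + k ≠ 0) (n : ℕ) :
    27 / 16 * (1 / 6 + k) * (5 / 6 + k) * seriesTerm (k + 1) n - (1 + k) ^ 2 * seriesTerm k n =
      wzMate k (n + 1) - wzMate k n := by
  have hn : 1 + k + n ≠ 0 := fun h => hk n (by linear_combination h)
  have hn1 : (1 + n : ℂ) ≠ 0 := by rw [add_comm]; exact_mod_cast Nat.succ_ne_zero n
  have hs := seriesCoeff_shift hk n
  have hs' : 27 / 16 * (1 / 6 + k) * (5 / 6 + k) * seriesCoeff (k + 1) n =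
      1 / 2 * (1 / 4 + 3 * k / 2 + n) * (3 / 4 + 3 * k / 2 + n) * (5 / 4 + 3 * k / 2 + n) *
        (1 / 2 + k + n) * ((1 + k) ^ 2 / (1 + k + n) ^ 2) * seriesCoeff k n / (1 / 2 + k) ^ 2 := by
    rw [eq_div_iff (pow_ne_zero 2 hk2), ← hs]; ring
  rw [seriesTerm_eq, seriesTerm_eq, ← mul_assoc, hs', wzMate, wzMate, seriesCoeff_succ]
  push_cast
  set t := seriesCoeff k n
  generalize (n : ℂ) = x at *
  have ha : ((1 : ℂ) / 2 + k) = (1 + 2 * k) / 2 := by ring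
  have hb : 1 + 2 * k ≠ 0 := fun h => hk2 (by rw [ha, h]; simp)
  rw [ha]
  field_simp
  ring

/-! ### Convergence and the recursion in k -/

theorem tendsto_add_natCast_div (a b : ℂ) :
    Tendsto (fun n : ℕ => (a + n) / (b + n)) atTop (𝓝 1) := by
  have h := tendsto_inv_atTop_nhds_zero_nat (𝕜 := ℂ)
  have h1 : Tendsto (fun n : ℕ => (a * (n : ℂ)⁻¹ + 1) / (b * (n : ℂ)⁻¹ + 1)) atTop
      (𝓝 ((a * 0 + 1) / (b * 0 + 1))) :=
    ((h.const_mul a).add_const 1).div ((h.const_mul b).add_const 1) (by simp)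
  rw [show (a * 0 + 1) / (b * 0 + 1) = (1 : ℂ) by simp] at h1
  refine h1.congr' ?_
  filter_upwards [eventually_ne_atTop 0] with n hn
  have : (n : ℂ) ≠ 0 := by exact_mod_cast hn
  rw [← mul_div_mul_right _ _ this]
  congr 1 <;> field_simp

/-- The coefficient ratio tends to -1/4, so any polynomial weight is harmless. The fourth power
dominates both the linear factor of the term and the cubic factor of `wzMate`. -/
theorem summable_pow_mul_seriesCoeff (k : ℂ) :
    Summable (fun n : ℕ => (1 + n : ℂ) ^ 4 * seriesCoeff k n) := by
  have ht : Tendsto (fun n : ℕ => (-1 / 4 : ℂ) * (((2 + n) / (1 + n)) ^ 4 *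
      ((1 / 2 + k + n) / (1 + k + n)) * ((1 / 4 + 3 * k / 2 + n) / (1 + k + n)) *
      ((3 / 4 + 3 * k / 2 + n) / (1 + n)))) atTop (𝓝 ((-1 / 4) * (1 ^ 4 * 1 * 1 * 1))) :=
    (((((tendsto_add_natCast_div _ _).pow 4).mul (tendsto_add_natCast_div _ _)).mul
      (tendsto_add_natCast_div _ _)).mul (tendsto_add_natCast_div _ _)).const_mul _
  have hev := ht.norm.eventually_le_const (u := 1 / 2) (by norm_num)
  refine summable_of_ratio_norm_eventually_le (r := 1 / 2) (by norm_num) ?_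
  filter_upwards [hev] with n hn
  have hn1 : (1 + n : ℂ) ≠ 0 := by rw [add_comm]; exact_mod_cast Nat.succ_ne_zero n
  refine le_trans (le_of_eq ?_) (mul_le_mul_of_nonneg_right hn (norm_nonneg _))
  rw [← norm_mul, seriesCoeff_succ]
  congr 1
  push_cast
  simp only [div_eq_mul_inv, mul_inv, mul_pow, inv_pow]
  field_simp
  ring

theorem summable_seriesTerm (k : ℂ) : Summable (seriesTerm k) := by
  have h := summable_pow_mul_seriesCoeff k
  refine Summable.of_norm_bounded (h.norm.mul_left (20 + ‖18 * k + 3‖)) fun n => ?_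
  rw [seriesTerm_eq, norm_mul, norm_mul, mul_comm ‖seriesCoeff k n‖, ← mul_assoc]
  refine mul_le_mul_of_nonneg_right ?_ (norm_nonneg _)
  have e : ‖(1 + n : ℂ) ^ 4‖ = (1 + n : ℝ) ^ 4 := by
    rw [norm_pow]; congr 1; exact_mod_cast Complex.norm_natCast (1 + n)
  have h1 : (1 + n : ℝ) ≤ (1 + n : ℝ) ^ 4 := le_self_pow₀ (by simp) (by norm_num)
  rw [e]
  calc ‖20 * (n : ℂ) + 18 * k + 3‖ ≤ 20 * n + ‖18 * k + 3‖ := by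
        rw [add_assoc]; refine (norm_add_le _ _).trans ?_; simp
    _ ≤ (20 + ‖18 * k + 3‖) * (1 + n) := by
        nlinarith [norm_nonneg (18 * k + 3), (Nat.cast_nonneg n : (0 : ℝ) ≤ n)]
    _ ≤ _ := by gcongr

theorem tendsto_wzMate (k : ℂ) : Tendsto (wzMate k) atTop (𝓝 0) := by
  have h := (summable_pow_mul_seriesCoeff k).tendsto_atTop_zero.norm
  rw [norm_zero] at h
  set c := 8 + ‖12 + 32 * k‖ + ‖-22 * k ^ 2 - 12 * k - 1 / 2‖ with hc
  have h2 := (h.const_mul c).mul_const ‖((1 + k) / (1 / 2 + k)) ^ 2‖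
  rw [mul_zero, zero_mul] at h2
  refine squeeze_zero_norm (fun n => ?_) h2
  rw [wzMate, norm_mul]
  refine mul_le_mul_of_nonneg_right ?_ (norm_nonneg _)
  rw [norm_mul, norm_mul ((1 + (n : ℂ)) ^ 4), mul_comm ‖seriesCoeff k n‖, ← mul_assoc]
  refine mul_le_mul_of_nonneg_right ?_ (norm_nonneg _)
  have e : ‖(1 + n : ℂ) ^ 4‖ = (1 + n : ℝ) ^ 4 := by
    rw [norm_pow]; congr 1; exact_mod_cast Complex.norm_natCast (1 + n)
  rw [e, norm_mul, Complex.norm_natCast]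
  have hn : (0 : ℝ) ≤ n := Nat.cast_nonneg n
  have h3 : ‖-8 * (n : ℂ) ^ 2 - (12 + 32 * k) * n - 22 * k ^ 2 - 12 * k - 1 / 2‖ ≤
      c * (1 + n) ^ 2 := by
    have : -8 * (n : ℂ) ^ 2 - (12 + 32 * k) * n - 22 * k ^ 2 - 12 * k - 1 / 2 =
      -8 * (n : ℂ) ^ 2 + -((12 + 32 * k) * n) + (-22 * k ^ 2 - 12 * k - 1 / 2) := by ring
    rw [this]
    refine (norm_add₃_le).trans ?_
    rw [norm_neg, norm_mul, norm_mul, norm_pow, Complex.norm_natCast, hc]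
    have := norm_nonneg (12 + 32 * k)
    have := norm_nonneg (-22 * k ^ 2 - 12 * k - 1 / 2)
    have h8 : ‖(-8 : ℂ)‖ = 8 := by simp
    rw [h8, add_mul, add_mul]
    gcongr
    · linarith
    · nlinarith
    · exact le_mul_of_one_le_right this (by nlinarith)
  calc (n : ℝ) * _ ≤ (1 + n) * (c * (1 + n) ^ 2) := by gcongr; linarith
    _ = c * (1 + n) ^ 3 := by ring
    _ ≤ c * (1 + n) ^ 4 := by
      have : 0 ≤ c := by positivity
      gcongr
      · linarith
      · norm_num

theorem tsum_seriesTerm_recursion {k : ℂ} (hk : ∀ m : ℕ, k ≠ -((m : ℂ) + 1))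
    (hk2 : 1 / 2 + k ≠ 0) :
    27 / 16 * (1 / 6 + k) * (5 / 6 + k) * ∑' n, seriesTerm (k + 1) n =
      (1 + k) ^ 2 * ∑' n, seriesTerm k n := by
  have h := ((summable_seriesTerm (k + 1)).hasSum.mul_left
    (27 / 16 * (1 / 6 + k) * (5 / 6 + k))).sub ((summable_seriesTerm k).hasSum.mul_left ((1 + k) ^ 2))
  have h1 := h.tendsto_sum_nat
  simp only [wz_relation hk hk2, Finset.sum_range_sub] at h1
  have h2 := (tendsto_wzMate k).sub_const (wzMate k 0)
  have h3 := tendsto_nhds_unique h1 h2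
  -- The factor n in `wzMate` kills the lower boundary term.
  rw [show wzMate k 0 = 0 by simp [wzMate], sub_zero] at h3
  exact sub_eq_zero.mp h3

/-! ### The special values k = 1/2 and k = -1/2 -/

/-- At k = 1/2 the coefficient c_n reduces to (-1/4)^n (1)_n / (3/2)_n, and the term is the
difference of 8(2n + 1)c_n at n and n + 1. -/
theorem hasSum_seriesTerm_half : HasSum (seriesTerm (1 / 2)) 8 := by
  have hf : ∀ n, seriesTerm (1 / 2) n =
      8 * (2 * n + 1) * seriesCoeff (1 / 2) n -
        8 * (2 * (n + 1 : ℕ) + 1) * seriesCoeff (1 / 2) (n + 1) := by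
    intro n
    have h1 : (1 + n : ℂ) ≠ 0 := by rw [add_comm]; exact_mod_cast Nat.succ_ne_zero n
    have h2 : (3 + 2 * n : ℂ) ≠ 0 := by exact_mod_cast (by omega : 3 + 2 * n ≠ 0)
    rw [seriesTerm_eq, seriesCoeff_succ,
      show (1 + 1 / 2 + n : ℂ) = (3 + 2 * n) / 2 by ring]
    push_cast
    field_simp
    ring
  have hs := (summable_seriesTerm (1 / 2)).hasSum
  have h1 := hs.tendsto_sum_nat
  have h4 := (summable_pow_mul_seriesCoeff (1 / 2)).tendsto_atTop_zero
  have h5 : Tendsto (fun n : ℕ => 8 * (2 * (n : ℂ) + 1) * seriesCoeff (1 / 2) n) atTop (𝓝 0) := by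
    have h6 := h4.norm.const_mul 16
    rw [norm_zero, mul_zero] at h6
    refine squeeze_zero_norm (fun n => ?_) h6
    rw [norm_mul, norm_mul ((1 + (n : ℂ)) ^ 4), ← mul_assoc]
    refine mul_le_mul_of_nonneg_right ?_ (norm_nonneg _)
    have e : ‖(1 + n : ℂ) ^ 4‖ = (1 + n : ℝ) ^ 4 := by
      rw [norm_pow]; congr 1; exact_mod_cast Complex.norm_natCast (1 + n)
    have e2 : ‖8 * (2 * (n : ℂ) + 1)‖ = 8 * (2 * n + 1) := by
      exact_mod_cast Complex.norm_natCast (8 * (2 * n + 1))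
    have h1 : (1 + n : ℝ) ≤ (1 + n : ℝ) ^ 4 := le_self_pow₀ (by simp) (by norm_num)
    rw [e, e2]
    linarith
  simp only [hf, Finset.sum_range_sub'] at h1
  have h7 := (tendsto_nhds_unique (h5.const_sub _) h1)
  rw [sub_zero] at h7
  have h8 : (8 * (2 * ((0 : ℕ) : ℂ) + 1) * seriesCoeff (1 / 2) 0) = 8 := by simp [seriesCoeff]
  rw [h8] at h7
  rw [h7]
  simpa only [← hf] using hs

theorem hasSum_seriesTerm_neg_half : HasSum (seriesTerm (-1 / 2)) (-6) := by
  have h : seriesTerm (-1 / 2) 0 = -6 := by norm_num [seriesTerm]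
  rw [← h]
  refine hasSum_single 0 fun n hn => ?_
  obtain ⟨m, rfl⟩ := Nat.exists_eq_succ_of_ne_zero hn
  have : (ascPochhammer ℂ (m + 1)).eval (1 / 2 + -1 / 2) = 0 := by
    rw [ascPochhammer_succ_left]; norm_num
  rw [seriesTerm, Nat.succ_eq_add_one, this]
  simp only [zero_mul, zero_div, mul_zero]

/-! ### Growth and holomorphy on the right half plane -/

/-- The ratio of consecutive coefficients is at most 1/4 · 3/2 · (n + 1 + N)/(n + 1), and the last
factor is the ratio of consecutive binomials. The resulting majorant sums in closed form. -/
theorem norm_seriesCoeff_le {k : ℂ} (hk : 0 ≤ k.re) {N : ℕ} (hN : 3 / 2 * ‖k‖ ≤ N) (n : ℕ) :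
    ‖seriesCoeff k n‖ ≤ (3 / 8) ^ n * ((n + N).choose N : ℝ) := by
  induction n with
  | zero => simp [seriesCoeff]
  | succ n ih =>
    have hn : (0 : ℝ) ≤ n := Nat.cast_nonneg n
    have hre : 0 < ‖1 + k + n‖ := by
      refine lt_of_lt_of_le ?_ ((le_abs_self _).trans (Complex.abs_re_le_norm _))
      simp; linarith
    have h1 : ‖1 / 2 + k + n‖ ≤ ‖1 + k + n‖ := by
      rw [← sq_le_sq₀ (norm_nonneg _) (norm_nonneg _), ← Complex.normSq_eq_norm_sq,
        ← Complex.normSq_eq_norm_sq, Complex.normSq_apply, Complex.normSq_apply]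
      simp
      nlinarith
    have h2 : ‖1 / 4 + 3 * k / 2 + n‖ ≤ 3 / 2 * ‖1 + k + n‖ := by
      have e : 3 / 2 * ‖1 + k + n‖ = ‖3 / 2 * (1 + k + n)‖ := by rw [norm_mul]; simp
      rw [e, ← sq_le_sq₀ (norm_nonneg _) (norm_nonneg _), ← Complex.normSq_eq_norm_sq,
        ← Complex.normSq_eq_norm_sq, Complex.normSq_apply, Complex.normSq_apply]
      have e1 : (1 / 4 + 3 * k / 2 + n).re = 1 / 4 + 3 / 2 * k.re + n := by
        norm_num [Complex.add_re, Complex.mul_re, Complex.div_re, Complex.normSq_apply]; ring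
      have e2 : (1 / 4 + 3 * k / 2 + n).im = 3 / 2 * k.im := by
        norm_num [Complex.add_im, Complex.mul_im, Complex.div_im, Complex.normSq_apply]; ring
      have e3 : (3 / 2 * (1 + k + n)).re = 3 / 2 * (1 + k.re + n) := by
        norm_num [Complex.mul_re, Complex.div_re, Complex.div_im]
      have e4 : (3 / 2 * (1 + k + n)).im = 3 / 2 * k.im := by
        norm_num [Complex.mul_im, Complex.div_re, Complex.div_im]
      rw [e1, e2, e3, e4]
      have : 1 / 4 + 3 / 2 * k.re + n ≤ 3 / 2 * (1 + k.re + n) := by linarith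
      have := mul_self_le_mul_self (by positivity) this
      linarith
    have h3 : ‖3 / 4 + 3 * k / 2 + n‖ ≤ n + 1 + N := by
      refine (norm_add₃_le).trans ?_
      rw [show 3 * k / 2 = 3 / 2 * k by ring, norm_mul, Complex.norm_natCast]
      norm_num
      linarith
    have hn1 : ‖(1 + n : ℂ)‖ = n + 1 := by
      rw [add_comm]; exact_mod_cast Complex.norm_natCast (n + 1)
    have hc : ((n + 1 + N).choose N : ℝ) = (n + N).choose N * ((n + 1 + N) / (n + 1)) := by
      have := Nat.choose_mul_succ_eq (n + N) N
      rw [show n + N + 1 - N = n + 1 by omega, show n + N + 1 = n + 1 + N by ring] at this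
      rw [← mul_div_assoc, eq_div_iff (by positivity)]
      exact_mod_cast this.symm
    rw [seriesCoeff_succ, norm_mul, hc, pow_succ (3 / 8 : ℝ)]
    have h4 : ‖(-1 / 4 : ℂ) * ((1 / 2 + k + n) * (1 / 4 + 3 * k / 2 + n) * (3 / 4 + 3 * k / 2 + n) /
        ((1 + k + n) ^ 2 * (1 + n)))‖ ≤ 3 / 8 * ((n + 1 + N) / (n + 1)) := by
      have h0 : ‖(-1 / 4 : ℂ)‖ = 1 / 4 := by norm_num
      rw [norm_mul, h0, norm_div, norm_mul, norm_mul, norm_mul, norm_pow, hn1]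
      calc _ ≤ 1 / 4 * (‖1 + k + n‖ * (3 / 2 * ‖1 + k + n‖) * (n + 1 + N) /
            (‖1 + k + n‖ ^ 2 * (n + 1))) := by gcongr
        _ = _ := by field_simp; ring
    calc _ ≤ (3 / 8) ^ n * ((n + N).choose N : ℝ) * (3 / 8 * ((n + 1 + N) / (n + 1))) := by gcongr
      _ = _ := by ring

theorem norm_seriesTerm_le {k : ℂ} (hk : 0 ≤ k.re) {N : ℕ} (hN : 3 / 2 * ‖k‖ ≤ N) (n : ℕ) :
    ‖seriesTerm k n‖ ≤ 20 * (N + 1) * (((n + (N + 1)).choose (N + 1) : ℝ) * (3 / 8) ^ n) := by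
  have h1 : ‖20 * (n : ℂ) + 18 * k + 3‖ ≤ 20 * (n + N + 1) := by
    refine (norm_add₃_le).trans ?_
    rw [norm_mul, norm_mul, Complex.norm_natCast]
    norm_num
    linarith [norm_nonneg k]
  have hc : ((n + N).choose N : ℝ) * (n + N + 1) = (N + 1) * (n + (N + 1)).choose (N + 1) := by
    have := Nat.add_one_mul_choose_eq (n + N) N
    rw [mul_comm, mul_comm (N + 1 : ℝ)]
    exact_mod_cast this
  rw [seriesTerm_eq, norm_mul]
  calc _ ≤ (3 / 8) ^ n * ((n + N).choose N : ℝ) * (20 * (n + N + 1)) := by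
        gcongr; exact norm_seriesCoeff_le hk hN n
    _ = 20 * (3 / 8) ^ n * (((n + N).choose N : ℝ) * (n + N + 1)) := by ring
    _ = _ := by rw [hc]; ring

theorem norm_tsum_seriesTerm_le {k : ℂ} (hk : 0 ≤ k.re) {N : ℕ} (hN : 3 / 2 * ‖k‖ ≤ N) :
    ‖∑' n, seriesTerm k n‖ ≤ 60 * (16 / 5) ^ N := by
  have hs := hasSum_choose_mul_geometric_of_norm_lt_one (𝕜 := ℝ) (N + 1) (r := 3 / 8) (by norm_num)
  refine (tsum_of_norm_bounded (hs.mul_left (20 * (N + 1 : ℝ))) (norm_seriesTerm_le hk hN)).trans ?_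
  -- Absorbing N + 1 into 2^N turns the base 8/5 into 16/5, and 20 · (8/5)² = 51.2 ≤ 60.
  have h2 : (N + 1 : ℝ) ≤ 2 ^ N := by exact_mod_cast Nat.lt_two_pow_self (n := N)
  rw [show (1 - 3 / 8 : ℝ) = (8 / 5)⁻¹ by norm_num, inv_pow, one_div, inv_inv]
  calc 20 * (N + 1) * (8 / 5 : ℝ) ^ (N + 1 + 1) ≤ 20 * 2 ^ N * (8 / 5) ^ (N + 1 + 1) := by gcongr
    _ = 20 * (8 / 5) ^ 2 * (2 * (8 / 5)) ^ N := by rw [mul_pow]; ring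
    _ ≤ 60 * (16 / 5) ^ N := by
      rw [show (2 * (8 / 5) : ℝ) = 16 / 5 by norm_num]; gcongr; norm_num

theorem norm_tsum_seriesTerm_le_exp {k : ℂ} (hk : 0 ≤ k.re) :
    ‖∑' n, seriesTerm k n‖ ≤ 60 * Real.exp (2 + 3 * ‖k‖) := by
  refine (norm_tsum_seriesTerm_le hk (Nat.le_ceil (3 / 2 * ‖k‖))).trans ?_
  have h1 : (16 / 5 : ℝ) ≤ Real.exp 2 := by
    have := Real.exp_one_gt_d9
    rw [show (2 : ℝ) = 1 + 1 by norm_num, Real.exp_add]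
    nlinarith
  have h2 : (⌈3 / 2 * ‖k‖⌉₊ : ℝ) ≤ 3 / 2 * ‖k‖ + 1 := (Nat.ceil_lt_add_one (by positivity)).le
  gcongr
  calc (16 / 5 : ℝ) ^ ⌈3 / 2 * ‖k‖⌉₊ ≤ Real.exp 2 ^ ⌈3 / 2 * ‖k‖⌉₊ := by gcongr
    _ = Real.exp (⌈3 / 2 * ‖k‖⌉₊ * 2) := by rw [← Real.exp_nat_mul]
    _ ≤ _ := by gcongr; linarith

theorem differentiable_ascPochhammer_eval (n : ℕ) :
    Differentiable ℂ fun x : ℂ => (ascPochhammer ℂ n).eval x :=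
  Polynomial.differentiable _

/-- Weierstrass M-test near each point: a single N serves a whole ball, so the majorant is uniform
there. -/
theorem differentiableOn_tsum_seriesTerm :
    DifferentiableOn ℂ (fun k => ∑' n, seriesTerm k n) {k | 0 < k.re} := by
  intro z hz
  obtain ⟨N, hN⟩ := exists_nat_ge (3 / 2 * (‖z‖ + 1))
  have hopen : IsOpen ({k : ℂ | 0 < k.re} ∩ Metric.ball 0 (‖z‖ + 1)) :=
    (isOpen_lt continuous_const Complex.continuous_re).inter Metric.isOpen_ball
  have hzm : z ∈ {k : ℂ | 0 < k.re} ∩ Metric.ball 0 (‖z‖ + 1) := ⟨hz, by simp⟩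
  have hs := hasSum_choose_mul_geometric_of_norm_lt_one (𝕜 := ℝ) (N + 1) (r := 3 / 8) (by norm_num)
  refine DifferentiableAt.differentiableWithinAt (DifferentiableOn.differentiableAt
    (Complex.differentiableOn_tsum_of_summable_norm (hs.summable.mul_left (20 * (N + 1 : ℝ)))
      (fun n => ?_) hopen fun n w hw => ?_) (hopen.mem_nhds hzm))
  · intro w hw
    have hne : (ascPochhammer ℂ n).eval (1 + w) ^ 2 * (ascPochhammer ℂ n).eval (1 : ℂ) ≠ 0 := by
      refine mul_ne_zero (pow_ne_zero 2 (ascPochhammer_eval_ne_zero (fun m h => ?_) n))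
        (ascPochhammer_eval_ne_zero (fun m h => ?_) n)
      · have hw1 : 0 < w.re := hw.1
        have := congrArg Complex.re h
        simp at this
        linarith [(Nat.cast_nonneg m : (0 : ℝ) ≤ m)]
      · rw [add_comm] at h
        exact Nat.succ_ne_zero m (by exact_mod_cast h)
    have hd := differentiable_ascPochhammer_eval n
    have hA : Differentiable ℂ fun k : ℂ => (ascPochhammer ℂ n).eval (1 / 2 + k) :=
      hd.comp (by fun_prop)
    have hB : Differentiable ℂ fun k : ℂ => (ascPochhammer ℂ n).eval (1 / 4 + 3 * k / 2) :=
      hd.comp (by fun_prop)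
    have hC : Differentiable ℂ fun k : ℂ => (ascPochhammer ℂ n).eval (3 / 4 + 3 * k / 2) :=
      hd.comp (by fun_prop)
    have hQ : Differentiable ℂ fun k : ℂ => (ascPochhammer ℂ n).eval (1 + k) :=
      hd.comp (by fun_prop)
    refine DifferentiableAt.differentiableWithinAt ?_
    unfold seriesTerm
    refine ((((hA w).mul (hB w)).mul (hC w)).div (((hQ w).pow 2).mul_const _) hne).const_mul _
      |>.mul (by fun_prop)
  · refine norm_seriesTerm_le hw.1.le (le_trans ?_ hN) n
    have : ‖w‖ < ‖z‖ + 1 := by simpa using hw.2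
    gcongr

/-! ### A Carlson-type theorem for periodic functions -/

theorem norm_cos_ge (x y : ℝ) :
    (Real.exp |y| - 1) / 2 ≤ ‖Complex.cos (x + y * Complex.I)‖ := by
  have key : ∀ u v : ℂ, ‖u‖ - ‖v‖ ≤ ‖u + v‖ := fun u v => by
    have := norm_sub_norm_le u (-v); rwa [norm_neg, sub_neg_eq_add] at this
  rw [Complex.cos, norm_div, Complex.norm_two]
  refine div_le_div_of_nonneg_right ?_ (by norm_num)
  have e1 : ‖Complex.exp ((x + y * Complex.I) * Complex.I)‖ = Real.exp (-y) := by
    rw [Complex.norm_exp]; simp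
  have e2 : ‖Complex.exp (-(x + y * Complex.I) * Complex.I)‖ = Real.exp y := by
    rw [Complex.norm_exp]; simp
  rcases le_total 0 y with h | h
  · rw [abs_of_nonneg h, add_comm (Complex.exp _)]
    refine le_trans ?_ (key _ _)
    rw [e1, e2]
    have : Real.exp (-y) ≤ 1 := Real.exp_le_one_iff.2 (by linarith)
    linarith
  · rw [abs_of_nonpos h]
    refine le_trans ?_ (key _ _)
    rw [e1, e2]
    have : Real.exp y ≤ 1 := Real.exp_le_one_iff.2 h
    linarith

/-- Division by `cos (π z)` of a holomorphic function vanishing at the zeros of the cosine. -/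
theorem exists_differentiableOn_mul_cos {U : Set ℂ} (hU : IsOpen U) {g : ℂ → ℂ}
    (hg : DifferentiableOn ℂ g U)
    (hz : ∀ z ∈ U, Complex.cos (Real.pi * z) = 0 → g z = 0) :
    ∃ h : ℂ → ℂ, DifferentiableOn ℂ h U ∧ ∀ z ∈ U, h z * Complex.cos (Real.pi * z) = g z := by
  set c : ℂ → ℂ := fun z => Complex.cos (Real.pi * z) with hc
  have hcd : Differentiable ℂ c := by fun_prop
  have hderiv : ∀ z, deriv c z = -Complex.sin (Real.pi * z) * Real.pi := fun z => by
    have : HasDerivAt c (-Complex.sin (Real.pi * z) * (Real.pi * 1)) z :=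
      (Complex.hasDerivAt_cos _).comp z ((hasDerivAt_id z).const_mul (Real.pi : ℂ))
    rw [this.deriv, mul_one]
  -- The zeros of the cosine are simple, so the singularities are removable, with values given by
  -- the ratio of derivatives; near a zero the quotient is the ratio of the two `dslope`s.
  refine ⟨fun z => if c z = 0 then deriv g z / deriv c z else g z / c z, ?_, ?_⟩
  · intro w hw
    refine DifferentiableAt.differentiableWithinAt ?_
    have hgw : DifferentiableAt ℂ g w := hg.differentiableAt (hU.mem_nhds hw)
    by_cases hcw : c w = 0
    · have hd0 : deriv c w ≠ 0 := by
        rw [hderiv]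
        refine mul_ne_zero (neg_ne_zero.2 fun hs => ?_) (by exact_mod_cast Real.pi_ne_zero)
        have := Complex.sin_sq_add_cos_sq (Real.pi * w)
        rw [hs, show Complex.cos (Real.pi * w) = 0 from hcw] at this
        norm_num at this
      have hdc : DifferentiableOn ℂ (dslope c w) Set.univ :=
        (Complex.differentiableOn_dslope univ_mem).2 hcd.differentiableOn
      have hdg : DifferentiableAt ℂ (dslope g w) w :=
        ((Complex.differentiableOn_dslope (hU.mem_nhds hw)).2 hg).differentiableAt (hU.mem_nhds hw)
      have hdc' : DifferentiableAt ℂ (dslope c w) w := hdc.differentiableAt univ_mem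
      have hne : dslope c w w ≠ 0 := by rwa [dslope_same]
      refine (hdg.div hdc' hne).congr_of_eventuallyEq ?_
      filter_upwards [hdc'.continuousAt.eventually_ne hne] with z hz0
      by_cases hzw : z = w
      · subst hzw; simp [hcw, dslope_same]
      · have hsub : z - w ≠ 0 := sub_ne_zero.2 hzw
        have e1 : c z = (z - w) * dslope c w z := by
          have := sub_smul_dslope c w z
          rw [hcw, sub_zero, smul_eq_mul] at this; exact this.symm
        have e2 : g z = (z - w) * dslope g w z := by
          have := sub_smul_dslope g w z
          rw [hz w hw hcw, sub_zero, smul_eq_mul] at this; exact this.symm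
        have : c z ≠ 0 := by rw [e1]; exact mul_ne_zero hsub hz0
        simp only [this, if_false, Pi.div_apply]
        rw [e1, e2, mul_div_mul_left _ _ hsub]
    · refine (hgw.div (hcd w) hcw).congr_of_eventuallyEq ?_
      filter_upwards [(hcd w).continuousAt.eventually_ne hcw] with z hz0
      simp [hz0]
  · intro z hzU
    by_cases hcz : c z = 0
    · simp only [hcz, if_true]
      rw [hz z hzU hcz, show Complex.cos (Real.pi * z) = 0 from hcz, mul_zero]
    · simp only [hcz, if_false]
      exact div_mul_cancel₀ _ hcz

/-- A periodic form of Carlson's theorem: a `1`-periodic holomorphic function on the right half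
plane, of exponential type less than `π` in the imaginary direction, vanishes if it vanishes at
`1 / 2`. -/
theorem eq_zero_of_periodic_of_exponential_type {g : ℂ → ℂ}
    (hg : DifferentiableOn ℂ g {z | 0 < z.re})
    (hper : ∀ z : ℂ, 0 < z.re → g (z + 1) = g z) (hhalf : g (1 / 2) = 0)
    {C a : ℝ} (ha : a < Real.pi)
    (hbd : ∀ z : ℂ, 1 ≤ z.re → z.re ≤ 2 → ‖g z‖ ≤ C * Real.exp (a * |z.im|))
    {z : ℂ} (hz : 0 < z.re) : g z = 0 := by
  have hopen : IsOpen {z : ℂ | 0 < z.re} := isOpen_lt continuous_const Complex.continuous_re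
  have hcos0 : ∀ w ∈ {z : ℂ | 0 < z.re}, Complex.cos (Real.pi * w) = 0 → g w = 0 := by
    intro w hw hc
    obtain ⟨m, hm⟩ := Complex.cos_eq_zero_iff.1 hc
    have hpi : (Real.pi : ℂ) ≠ 0 := by exact_mod_cast Real.pi_ne_zero
    have hwm : w = m + 1 / 2 := by
      have : (Real.pi : ℂ) * w = Real.pi * (m + 1 / 2) := by rw [hm]; ring
      exact mul_left_cancel₀ hpi this
    have hm0 : 0 ≤ m := by
      have h1 : 0 < w.re := hw
      rw [hwm] at h1
      simp at h1
      by_contra! hneg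
      have : (m : ℝ) ≤ -1 := by exact_mod_cast (by omega : m ≤ -1)
      norm_num at h1
      linarith
    lift m to ℕ using hm0
    rw [hwm]
    clear hm hwm
    induction m with
    | zero => simpa using hhalf
    | succ m ih =>
      rw [show (((m + 1 : ℕ) : ℤ) : ℂ) + 1 / 2 = ((m : ℤ) : ℂ) + 1 / 2 + 1 by push_cast; ring,
        hper _ (by simp; positivity), ih]
  -- Periodicity spreads the zero at 1/2 to all zeros of cos(πz) in the half plane. The quotient h
  -- then has 1-periodic modulus and decays vertically like exp(-(π - a)|Im z|). So |h| attains its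
  -- maximum, is constant by the maximum principle, and the decay contradicts a nonzero value.
  obtain ⟨h, hd, hh⟩ := exists_differentiableOn_mul_cos hopen hg hcos0
  have hcosne : ∀ w : ℂ, w.im ≠ 0 → Complex.cos (Real.pi * w) ≠ 0 := by
    intro w hw hc
    obtain ⟨m, hm⟩ := Complex.cos_eq_zero_iff.1 hc
    have := congrArg Complex.im hm
    rw [show ((2 * (m : ℂ) + 1) * Real.pi / 2) = (((2 * m + 1) * Real.pi / 2 : ℝ) : ℂ) by
      push_cast; ring, Complex.ofReal_im] at this
    simp at this
    exact hw this
  have hcont := hd.continuousOn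
  -- antiperiodicity, first off the real axis and then by continuity
  have hanti : ∀ w : ℂ, 0 < w.re → h (w + 1) = -h w := by
    have hoff : ∀ w : ℂ, 0 < w.re → w.im ≠ 0 → h (w + 1) = -h w := by
      intro w hw hi
      have h1 := hh (w + 1) (by simp only [Set.mem_ofPred_eq, Complex.add_re, Complex.one_re]; linarith)
      rw [hper w hw, ← hh w hw, mul_add, mul_one, Complex.cos_add_pi] at h1
      have h2 := hcosne w hi
      have : (h (w + 1) + h w) * Complex.cos (Real.pi * w) = 0 := by linear_combination -h1
      exact eq_neg_of_add_eq_zero_left ((mul_eq_zero.1 this).resolve_right h2)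
    intro w hw
    by_cases hi : w.im = 0
    · have hca : ∀ u : ℂ, 0 < u.re → ContinuousAt h u := fun u hu =>
        hcont.continuousAt (hopen.mem_nhds hu)
      have hp : ContinuousAt (fun t : ℝ => w + t * Complex.I) 0 := by fun_prop
      have h1 : ContinuousAt (fun t : ℝ => h (w + t * Complex.I + 1) + h (w + t * Complex.I)) 0 := by
        refine ContinuousAt.add ?_ ?_
        · refine ContinuousAt.comp (f := fun t : ℝ => w + t * Complex.I + 1) (hca _ ?_) (by fun_prop)
          simp; linarith
        · exact ContinuousAt.comp (f := fun t : ℝ => w + t * Complex.I) (hca _ (by simpa using hw)) hp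
      have h2 := h1.tendsto.mono_left (nhdsWithin_le_nhds (s := {0}ᶜ))
      have h3 : Tendsto (fun t : ℝ => h (w + t * Complex.I + 1) + h (w + t * Complex.I))
          (𝓝[≠] 0) (𝓝 0) := by
        refine tendsto_const_nhds.congr' ?_
        filter_upwards [self_mem_nhdsWithin] with t ht
        rw [hoff _ (by simpa using hw) (by simpa [hi] using ht), neg_add_cancel]
      have h4 := tendsto_nhds_unique h2 h3
      simp only [Complex.ofReal_zero, zero_mul, add_zero] at h4
      exact eq_neg_of_add_eq_zero_left h4
    · exact hoff w hw hi
  have hshift : ∀ (w : ℂ) (m : ℕ), 0 < w.re → ‖h (w + m)‖ = ‖h w‖ := by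
    intro w m hw
    induction m with
    | zero => simp
    | succ m ih =>
      rw [← ih, Nat.cast_succ, ← add_assoc, hanti, norm_neg]
      simp; positivity
  have hstrip : ∀ w : ℂ, 0 < w.re → ∃ v : ℂ, 1 ≤ v.re ∧ v.re ≤ 2 ∧ ‖h v‖ = ‖h w‖ := by
    intro w hw
    rcases lt_or_ge w.re 1 with h1 | h1
    · refine ⟨w + 1, ?_, ?_, by simpa using hshift w 1 hw⟩ <;> simp <;> linarith
    · have hf := Nat.floor_le hw.le
      have hf' := Nat.lt_floor_add_one w.re
      have hf1 : 1 ≤ ⌊w.re⌋₊ := Nat.le_floor (by simpa using h1)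
      obtain ⟨m, hm⟩ := Nat.exists_eq_add_of_le hf1
      rw [hm] at hf hf'
      push_cast at hf hf'
      have hr : (w - m).re = w.re - m := by simp
      refine ⟨w - m, by rw [hr]; linarith, by rw [hr]; linarith, ?_⟩
      have := hshift (w - m) m (by rw [hr]; linarith)
      rwa [sub_add_cancel, eq_comm] at this
  have hC : 0 ≤ C := by
    have := (norm_nonneg _).trans (hbd 1 (by simp) (by simp))
    simpa using this
  have hdecay : ∀ w : ℂ, 1 ≤ w.re → w.re ≤ 2 → 1 ≤ |w.im| →
      ‖h w‖ ≤ 4 * C * Real.exp (-((Real.pi - a) * |w.im|)) := by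
    intro w h1 h2 hi
    have hw0 : (0 : ℝ) < w.re := by linarith
    have hcg := norm_cos_ge (Real.pi * w.re) (Real.pi * w.im)
    have e : (((Real.pi * w.re : ℝ) : ℂ) + ((Real.pi * w.im : ℝ) : ℂ) * Complex.I) = Real.pi * w := by
      conv_rhs => rw [← Complex.re_add_im w]
      push_cast; ring
    rw [e, abs_mul, abs_of_pos Real.pi_pos] at hcg
    -- Once E = exp(π|Im w|) ≥ 2, (E - 1)/2 ≥ E/4; this is the source of the factor 4.
    have hexp : 2 ≤ Real.exp (Real.pi * |w.im|) := by
      have := Real.add_one_le_exp (Real.pi * |w.im|)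
      nlinarith [Real.pi_gt_three]
    have hcg' : Real.exp (Real.pi * |w.im|) / 4 ≤ ‖Complex.cos (Real.pi * w)‖ := by linarith
    have hb := hbd w h1 h2
    rw [← hh w hw0, norm_mul] at hb
    have h5 : ‖h w‖ * (Real.exp (Real.pi * |w.im|) / 4) ≤ C * Real.exp (a * |w.im|) :=
      (mul_le_mul_of_nonneg_left hcg' (norm_nonneg _)).trans hb
    have h6 : Real.exp (-((Real.pi - a) * |w.im|)) =
        Real.exp (a * |w.im|) / Real.exp (Real.pi * |w.im|) := by
      rw [← Real.exp_sub]; congr 1; ring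
    rw [h6, ← mul_div_assoc, le_div_iff₀ (Real.exp_pos _)]
    linarith
  suffices hz0 : h z = 0 by rw [← hh z hz, hz0, zero_mul]
  by_contra hne
  have hpos : 0 < ‖h z‖ := norm_pos_iff.2 hne
  have hlim : Tendsto (fun y : ℝ => 4 * C * Real.exp (-((Real.pi - a) * y))) atTop (𝓝 0) := by
    have h1 : Tendsto (fun y : ℝ => (Real.pi - a) * y) atTop atTop :=
      tendsto_id.const_mul_atTop (sub_pos.2 ha)
    simpa using (Real.tendsto_exp_neg_atTop_nhds_zero.comp h1).const_mul (4 * C)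
  obtain ⟨T, hT⟩ := (eventually_atTop.1 (hlim.eventually_lt_const hpos))
  have hsmall : ∀ w : ℂ, 1 ≤ w.re → w.re ≤ 2 → max T 1 ≤ |w.im| → ‖h w‖ < ‖h z‖ :=
    fun w h1 h2 h3 => (hdecay w h1 h2 ((le_max_right _ _).trans h3)).trans_lt
      (hT _ ((le_max_left _ _).trans h3))
  set S := max T 1 with hS
  have hS1 : 1 ≤ S := le_max_right _ _
  have hK : IsCompact (Set.Icc (1 : ℝ) 2 ×ℂ Set.Icc (-S) S) := isCompact_Icc.reProdIm isCompact_Icc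
  have hKsub : Set.Icc (1 : ℝ) 2 ×ℂ Set.Icc (-S) S ⊆ {z : ℂ | 0 < z.re} := fun w hw =>
    lt_of_lt_of_le one_pos (Complex.mem_reProdIm.1 hw).1.1
  have hmemK : ∀ v : ℂ, 1 ≤ v.re → v.re ≤ 2 → ‖h z‖ ≤ ‖h v‖ →
      v ∈ Set.Icc (1 : ℝ) 2 ×ℂ Set.Icc (-S) S := fun v h1 h2 h3 => by
    refine Complex.mem_reProdIm.2 ⟨⟨h1, h2⟩, abs_le.1 ?_⟩
    by_contra! h4
    exact absurd (hsmall v h1 h2 h4.le) (not_lt.2 h3)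
  obtain ⟨v0, hv1, hv2, hv⟩ := hstrip z hz
  have hv0K := hmemK v0 hv1 hv2 hv.ge
  obtain ⟨p, hpK, hp⟩ := hK.exists_isMaxOn ⟨v0, hv0K⟩ (hcont.mono hKsub).norm
  have hzp : ‖h z‖ ≤ ‖h p‖ := hv ▸ hp hv0K
  have hmax : IsMaxOn (norm ∘ h) {z : ℂ | 0 < z.re} p := by
    intro w hw
    obtain ⟨v, h1, h2, h3⟩ := hstrip w hw
    change ‖h w‖ ≤ ‖h p‖
    rw [← h3]
    rcases lt_or_ge ‖h v‖ ‖h z‖ with h4 | h4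
    · exact h4.le.trans hzp
    · exact hp (hmemK v h1 h2 h4)
  have hconn : IsPreconnected {z : ℂ | 0 < z.re} := (convex_halfSpace_re_gt 0).isPreconnected
  have heq := Complex.norm_eqOn_of_isPreconnected_of_isMaxOn hconn hopen hd (hKsub hpK) hmax
  have hq := hsmall (1 + S * Complex.I) (by simp) (by simp) (by simpa using le_abs_self S)
  have hq' : ‖h (1 + S * Complex.I)‖ = ‖h p‖ :=
    heq (show (0 : ℝ) < (1 + S * Complex.I : ℂ).re by simp)
  linarith

/-! ### Boundedness of Gamma quotients -/

theorem norm_betaIntegral_le {u v : ℂ} {x : ℝ} (hx : 0 < x) (hu : x ≤ u.re) (hv : 0 < v.re) :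
    ‖Complex.betaIntegral u v‖ ≤ ∫ t in (0 : ℝ)..1, t ^ (x - 1) * (1 - t) ^ (v.re - 1) := by
  have hint : IntervalIntegrable (fun t : ℝ => t ^ (x - 1) * (1 - t) ^ (v.re - 1))
      MeasureTheory.volume 0 1 := by
    have := (Complex.betaIntegral_convergent (u := x) (v := v) (by simpa using hx) hv).norm
    refine this.congr_ae ((MeasureTheory.ae_restrict_iff' measurableSet_uIoc).2 ?_)
    -- The endpoint t = 1 is discarded because the norm formula for powers needs 1 - t > 0.
    filter_upwards [MeasureTheory.measure_eq_zero_iff_ae_notMem.1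
      (MeasureTheory.measure_singleton (μ := MeasureTheory.volume) (1 : ℝ))] with t ht1 ht
    rw [Set.uIoc_of_le zero_le_one] at ht
    have h1 : t < 1 := lt_of_le_of_ne ht.2 ht1
    rw [norm_mul, Complex.norm_cpow_eq_rpow_re_of_pos ht.1,
      show (1 - t : ℂ) = ((1 - t : ℝ) : ℂ) by push_cast; ring,
      Complex.norm_cpow_eq_rpow_re_of_pos (sub_pos.2 h1)]
    simp
  refine intervalIntegral.norm_integral_le_of_norm_le zero_le_one ?_ hint
  filter_upwards [MeasureTheory.measure_eq_zero_iff_ae_notMem.1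
    (MeasureTheory.measure_singleton (μ := MeasureTheory.volume) (1 : ℝ))] with t ht1 ht
  have h0 : 0 < t := ht.1
  have h1 : t < 1 := lt_of_le_of_ne ht.2 ht1
  rw [norm_mul, Complex.norm_cpow_eq_rpow_re_of_pos h0,
    show (1 - t : ℂ) = ((1 - t : ℝ) : ℂ) by push_cast; ring,
    Complex.norm_cpow_eq_rpow_re_of_pos (sub_pos.2 h1)]
  simp only [Complex.sub_re, Complex.one_re]
  gcongr ?_ * _
  exact Real.rpow_le_rpow_of_exponent_ge h0 h1.le (by linarith)

/-- Γ(a + z)/Γ(1 + z) = B(a + z, 1 - a)/Γ(1 - a), and the modulus of the beta integrand is largest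
at Re z = 0. -/
theorem exists_norm_Gamma_div_le {a : ℝ} (ha0 : 0 < a) (ha1 : a < 1) :
    ∃ C : ℝ, ∀ z : ℂ, 0 ≤ z.re → ‖Complex.Gamma (a + z) / Complex.Gamma (1 + z)‖ ≤ C := by
  have hG : Complex.Gamma ((1 - a : ℝ) : ℂ) ≠ 0 :=
    Complex.Gamma_ne_zero_of_re_pos (by simpa using ha1)
  refine ⟨(∫ t in (0 : ℝ)..1, t ^ (a - 1) * (1 - t) ^ (((1 - a : ℝ) : ℂ).re - 1)) /
    ‖Complex.Gamma ((1 - a : ℝ) : ℂ)‖, fun z hz => ?_⟩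
  have h1 : Complex.Gamma (1 + z) ≠ 0 := Complex.Gamma_ne_zero_of_re_pos (by simp; linarith)
  have hB := Complex.Gamma_mul_Gamma_eq_betaIntegral (s := a + z) (t := ((1 - a : ℝ) : ℂ))
    (by simp; linarith) (by simpa using ha1)
  rw [show (a + z + ((1 - a : ℝ) : ℂ)) = 1 + z by push_cast; ring] at hB
  have e : Complex.Gamma (a + z) / Complex.Gamma (1 + z) =
      Complex.betaIntegral (a + z) ((1 - a : ℝ) : ℂ) / Complex.Gamma ((1 - a : ℝ) : ℂ) := by
    rw [div_eq_div_iff h1 hG, hB]; ring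
  rw [e, norm_div]
  gcongr
  exact norm_betaIntegral_le ha0 (by simpa using hz) (by simpa using ha1)

/-! ### The closed form and its recursion -/

/-- The closed form of the series. -/
noncomputable def seriesValue (k : ℂ) : ℂ :=
  8 / (Real.pi : ℂ) * (16 / 27 : ℂ) ^ k *
    (pochhammerC 1 k ^ 2 / (pochhammerC (1 / 6) k * pochhammerC (5 / 6) k))

theorem Gamma_sixth_mul : Complex.Gamma (1 / 6) * Complex.Gamma (5 / 6) = 2 * Real.pi := by
  have := Complex.Gamma_mul_Gamma_one_sub (1 / 6)
  rw [show (1 - 1 / 6 : ℂ) = 5 / 6 by norm_num] at this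
  rw [this, show (Real.pi * (1 / 6) : ℂ) = ((Real.pi / 6 : ℝ) : ℂ) by push_cast; ring,
    ← Complex.ofReal_sin, Real.sin_pi_div_six]
  push_cast
  field_simp

theorem seriesValue_eq (k : ℂ) : seriesValue k =
    16 * ((16 / 27 : ℂ) ^ k * Complex.Gamma (1 + k) ^ 2 /
      (Complex.Gamma (1 / 6 + k) * Complex.Gamma (5 / 6 + k))) := by
  have hpi : (Real.pi : ℂ) ≠ 0 := by exact_mod_cast Real.pi_ne_zero
  have e : 8 / (Real.pi : ℂ) * (Complex.Gamma (1 / 6) * Complex.Gamma (5 / 6)) = 16 := by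
    rw [Gamma_sixth_mul]; field_simp; norm_num
  rw [seriesValue]
  generalize (16 / 27 : ℂ) ^ k = X
  rw [← e]
  simp only [pochhammerC, Complex.Gamma_one, div_eq_mul_inv, mul_inv, inv_inv]
  ring

theorem Gamma_two_thirds_mul :
    Complex.Gamma (2 / 3) * Complex.Gamma (4 / 3) = 2 * Real.pi / (3 * Real.sqrt 3) := by
  have := Complex.Gamma_mul_Gamma_one_sub (1 / 3)
  rw [show (1 - 1 / 3 : ℂ) = 2 / 3 by norm_num,
    show (Real.pi * (1 / 3) : ℂ) = ((Real.pi / 3 : ℝ) : ℂ) by push_cast; ring,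
    ← Complex.ofReal_sin, Real.sin_pi_div_three] at this
  have h2 := Complex.Gamma_add_one (1 / 3) (by norm_num)
  rw [show (1 / 3 + 1 : ℂ) = 4 / 3 by norm_num] at h2
  rw [h2, mul_comm, mul_assoc, this]
  push_cast
  field_simp

theorem seriesValue_half : seriesValue (1 / 2) = 8 := by
  have h3 : (Real.sqrt 3 : ℂ) ^ 2 = 3 := by
    exact_mod_cast Real.sq_sqrt (by norm_num : (0 : ℝ) ≤ 3)
  have hs : (Real.sqrt 3 : ℂ) ≠ 0 := fun h => by rw [h] at h3; norm_num at h3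
  have hpi : (Real.pi : ℂ) ≠ 0 := by exact_mod_cast Real.pi_ne_zero
  have hpow : (16 / 27 : ℂ) ^ (1 / 2 : ℂ) = 4 / (3 * Real.sqrt 3) := by
    have h1 : (16 / 27 : ℝ) ^ (1 / 2 : ℝ) = 4 / (3 * Real.sqrt 3) := by
      rw [← Real.sqrt_eq_rpow, Real.sqrt_eq_iff_mul_self_eq (by norm_num) (by positivity)]
      have := Real.mul_self_sqrt (by norm_num : (0 : ℝ) ≤ 3)
      field_simp
      nlinarith
    have h2 := Complex.ofReal_cpow (by norm_num : (0 : ℝ) ≤ 16 / 27) (1 / 2)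
    rw [h1] at h2
    push_cast at h2
    exact h2.symm
  have hG : Complex.Gamma (1 + 1 / 2) ^ 2 = Real.pi / 4 := by
    rw [add_comm, Complex.Gamma_add_one _ (by norm_num), Complex.Gamma_one_half_eq, mul_pow,
      ← Complex.cpow_nat_mul]
    norm_num
    ring
  rw [seriesValue_eq, hpow, hG, show (1 / 6 + 1 / 2 : ℂ) = 2 / 3 by norm_num,
    show (5 / 6 + 1 / 2 : ℂ) = 4 / 3 by norm_num, Gamma_two_thirds_mul]
  field_simp
  norm_num

theorem seriesValue_recursion {k : ℂ} (hk : 1 + k ≠ 0) :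
    27 / 16 * (1 / 6 + k) * (5 / 6 + k) * seriesValue (k + 1) = (1 + k) ^ 2 * seriesValue k := by
  rw [seriesValue_eq, seriesValue_eq, ← add_assoc, ← add_assoc, ← add_assoc,
    Complex.Gamma_add_one _ hk, Complex.cpow_add _ _ (by norm_num), Complex.cpow_one]
  -- At a Gamma pole in the denominator both sides vanish: the left has a zero factor, and on the
  -- right `Complex.Gamma 0 = 0` makes the quotient 0, its true value.
  by_cases h1 : 1 / 6 + k = 0
  · rw [h1, Complex.Gamma_zero]; simp
  by_cases h2 : 5 / 6 + k = 0
  · rw [h2, Complex.Gamma_zero]; simp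
  rw [Complex.Gamma_add_one _ h1, Complex.Gamma_add_one _ h2]
  generalize Complex.Gamma (1 / 6 + k) = A
  generalize Complex.Gamma (5 / 6 + k) = B
  generalize 1 / 6 + k = a at *
  generalize 5 / 6 + k = b at *
  field_simp

/-! ### Identification on Re k > 0 and continuation to the left -/

theorem hasSum_seriesTerm_of_re_pos {k : ℂ} (hk : 0 < k.re) :
    HasSum (seriesTerm k) (seriesValue k) := by
  -- D is 16/V, written with quotients bounded for Re z ≥ 0; the periodic function is S · D - 16.
  set D : ℂ → ℂ := fun z => (27 / 16 : ℂ) ^ z *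
    ((Complex.Gamma (1 / 6 + z) / Complex.Gamma (1 + z)) *
      (Complex.Gamma (5 / 6 + z) / Complex.Gamma (1 + z))) with hD
  have hG1 : ∀ z : ℂ, 0 < z.re → Complex.Gamma (1 + z) ≠ 0 := fun z hz =>
    Complex.Gamma_ne_zero_of_re_pos (by simp; linarith)
  have hG2 : ∀ z : ℂ, 0 < z.re → Complex.Gamma (1 / 6 + z) ≠ 0 := fun z hz =>
    Complex.Gamma_ne_zero_of_re_pos (by norm_num; linarith)
  have hG3 : ∀ z : ℂ, 0 < z.re → Complex.Gamma (5 / 6 + z) ≠ 0 := fun z hz =>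
    Complex.Gamma_ne_zero_of_re_pos (by norm_num; linarith)
  have hc : (27 / 16 : ℂ) ≠ 0 := by norm_num
  have hcc : ∀ z : ℂ, (27 / 16 : ℂ) ^ z * (16 / 27 : ℂ) ^ z = 1 := fun z => by
    rw [show (16 / 27 : ℂ) = ((16 / 27 : ℝ) : ℂ) by push_cast; ring,
      show (27 / 16 : ℂ) = ((27 / 16 : ℝ) : ℂ) by push_cast; ring,
      ← Complex.mul_cpow_ofReal_nonneg (by norm_num) (by norm_num)]
    norm_num
  have hDR : ∀ z : ℂ, 0 < z.re → seriesValue z * D z = 16 := fun z hz => by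
    have h1 := hG1 z hz
    have h2 := hG2 z hz
    have h3 := hG3 z hz
    rw [seriesValue_eq, hD]
    beta_reduce
    generalize Complex.Gamma (1 / 6 + z) = A at *
    generalize Complex.Gamma (5 / 6 + z) = B at *
    generalize Complex.Gamma (1 + z) = G at *
    calc _ = 16 * ((27 / 16 : ℂ) ^ z * (16 / 27 : ℂ) ^ z) *
          (G ^ 2 / (A * B) * (A / G * (B / G))) := by ring
      _ = 16 := by rw [hcc]; field_simp
  have hGd : ∀ (a : ℝ), 0 < a → ∀ z : ℂ, 0 < z.re →
      DifferentiableAt ℂ (fun z => Complex.Gamma (a + z)) z := fun a ha z hz => by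
    refine DifferentiableAt.comp (f := fun z : ℂ => (a : ℂ) + z) z
      (Complex.differentiableAt_Gamma _ fun m hm => ?_) (by fun_prop)
    have := congrArg Complex.re hm
    simp at this
    linarith [(Nat.cast_nonneg m : (0 : ℝ) ≤ m)]
  have hDd : DifferentiableOn ℂ D {z | 0 < z.re} := fun z hz => by
    have h1 := hGd 1 (by norm_num) z hz
    have h2 := hGd (1 / 6) (by norm_num) z hz
    have h3 := hGd (5 / 6) (by norm_num) z hz
    push_cast at h1 h2 h3
    exact ((differentiableAt_id.const_cpow (Or.inl hc)).mul
      ((h2.div h1 (hG1 z hz)).mul (h3.div h1 (hG1 z hz)))).differentiableWithinAt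
  obtain ⟨C1, hC1⟩ := exists_norm_Gamma_div_le (a := 1 / 6) (by norm_num) (by norm_num)
  obtain ⟨C2, hC2⟩ := exists_norm_Gamma_div_le (a := 5 / 6) (by norm_num) (by norm_num)
  push_cast at hC1 hC2
  have hC1' : 0 ≤ C1 := (norm_nonneg _).trans (hC1 1 (by simp))
  have hgd : DifferentiableOn ℂ (fun z => (∑' n, seriesTerm z n) * D z - 16) {z | 0 < z.re} :=
    (differentiableOn_tsum_seriesTerm.mul hDd).sub_const _
  -- On the strip |z| ≤ 2 + |Im z|, so exp(2 + 3|z|) ≤ exp(8) exp(3|Im z|); the final 16 pays for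
  -- the subtracted constant.
  have hzero := eq_zero_of_periodic_of_exponential_type hgd (C := 60 * Real.exp 8 *
    ((27 / 16) ^ (2 : ℝ) * (C1 * C2)) + 16) (a := 3) ?_ ?_ Real.pi_gt_three ?_ hk
  · have hDk : D k ≠ 0 := fun h => by have := hDR k hk; rw [h] at this; norm_num at this
    have : (∑' n, seriesTerm k n) = seriesValue k := by
      refine mul_right_cancel₀ hDk ?_
      rw [hDR k hk, sub_eq_zero.1 hzero]
    rw [← this]
    exact (summable_seriesTerm k).hasSum
  · intro z hz
    have hzm : ∀ m : ℕ, z ≠ -((m : ℂ) + 1) := fun m hm => by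
      rw [hm] at hz; simp at hz; linarith [(Nat.cast_nonneg m : (0 : ℝ) ≤ m)]
    have hz2 : 1 / 2 + z ≠ 0 := fun hm => by
      have := congrArg Complex.re hm; norm_num at this; linarith
    have hz1 : 1 + z ≠ 0 := fun hm => hzm 0 (by linear_combination hm)
    have h1 := tsum_seriesTerm_recursion hzm hz2
    have h2 := seriesValue_recursion hz1
    have hv : seriesValue z ≠ 0 := fun h => by
      have := hDR z hz; rw [h] at this; norm_num at this
    have h3 := hDR z hz
    have h4 := hDR (z + 1) (by simp; linarith)
    have hv' : seriesValue (z + 1) ≠ 0 := fun h => by rw [h] at h4; norm_num at h4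
    have e : (∑' n, seriesTerm (z + 1) n) * seriesValue z =
        (∑' n, seriesTerm z n) * seriesValue (z + 1) := by
      refine mul_left_cancel₀ (pow_ne_zero 2 hz1) ?_
      calc _ = (∑' n, seriesTerm (z + 1) n) * ((1 + z) ^ 2 * seriesValue z) := by ring
        _ = (27 / 16 * (1 / 6 + z) * (5 / 6 + z) * ∑' n, seriesTerm (z + 1) n) *
            seriesValue (z + 1) := by rw [← h2]; ring
        _ = _ := by rw [h1]; ring
    rw [sub_left_inj]
    refine mul_right_cancel₀ (mul_ne_zero hv hv') ?_
    linear_combination (D (z + 1) * seriesValue (z + 1)) * e +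
      (∑' n, seriesTerm z n) * seriesValue (z + 1) * (h4 - h3)
  · have h1 := hDR (1 / 2) (by norm_num)
    rw [seriesValue_half] at h1
    change (∑' n, seriesTerm (1 / 2) n) * D (1 / 2) - 16 = 0
    rw [hasSum_seriesTerm_half.tsum_eq, h1, sub_self]
  · intro z h1 h2
    have hz0 : 0 ≤ z.re := by linarith
    have hnorm : ‖z‖ ≤ 2 + |z.im| := by
      refine (Complex.norm_le_abs_re_add_abs_im z).trans ?_
      rw [abs_of_nonneg hz0]; linarith
    have hb1 : ‖∑' n, seriesTerm z n‖ ≤ 60 * Real.exp 8 * Real.exp (3 * |z.im|) := by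
      refine (norm_tsum_seriesTerm_le_exp hz0).trans ?_
      rw [mul_assoc, ← Real.exp_add]
      gcongr 60 * ?_
      exact Real.exp_le_exp.2 (by linarith)
    have hb2 : ‖D z‖ ≤ (27 / 16) ^ (2 : ℝ) * (C1 * C2) := by
      rw [hD]
      simp only [norm_mul]
      have e : ‖(27 / 16 : ℂ) ^ z‖ = (27 / 16 : ℝ) ^ z.re := by
        rw [show (27 / 16 : ℂ) = ((27 / 16 : ℝ) : ℂ) by push_cast; ring,
          Complex.norm_cpow_eq_rpow_re_of_pos (by norm_num)]
      rw [e]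
      gcongr
      · norm_num
      · exact hC1 z hz0
      · exact hC2 z hz0
    have he : 1 ≤ Real.exp (3 * |z.im|) := Real.one_le_exp (by positivity)
    calc _ ≤ ‖∑' n, seriesTerm z n‖ * ‖D z‖ + 16 := by
          refine (norm_sub_le _ _).trans ?_
          rw [norm_mul]; simp
      _ ≤ 60 * Real.exp 8 * Real.exp (3 * |z.im|) * ((27 / 16) ^ (2 : ℝ) * (C1 * C2)) +
          16 * Real.exp (3 * |z.im|) := by
        gcongr
        linarith
      _ = _ := by ring

theorem hasSum_seriesTerm (k : ℂ) (hk : ∀ m : ℕ, k ≠ -((m : ℂ) + 1)) :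
    HasSum (seriesTerm k) (seriesValue k) := by
  -- Induction on the number of unit steps that bring k into Re k > 0.
  obtain ⟨N, hN⟩ := exists_nat_gt (-k.re)
  induction N generalizing k with
  | zero => exact hasSum_seriesTerm_of_re_pos (by simpa using hN)
  | succ N ih =>
    have h1k : 1 + k ≠ 0 := fun h => hk 0 (by linear_combination h)
    have hval := seriesValue_recursion h1k
    by_cases h2 : 1 / 2 + k = 0
    · have hk' : k = -1 / 2 := by linear_combination h2
      subst hk'
      rw [show (-1 / 2 + 1 : ℂ) = 1 / 2 by norm_num, seriesValue_half] at hval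
      -- The recursion for V needs only 1 + k ≠ 0, so it still gives V(-1/2) from V(1/2) = 8.
      have : seriesValue (-1 / 2) = -6 := by linear_combination -4 * hval
      rw [this]
      exact hasSum_seriesTerm_neg_half
    · have hs := ih (k + 1) (fun m hm => hk (m + 1) (by push_cast; linear_combination hm))
        (by push_cast at hN; simp; linarith)
      have hrec := tsum_seriesTerm_recursion hk h2
      rw [hs.tsum_eq, hval] at hrec
      rw [mul_left_cancel₀ (pow_ne_zero 2 h1k) hrec]
      exact (summable_seriesTerm k).hasSum

theorem mainTheorem11 :
    (∀ k : ℂ, (∀ m : ℕ, k ≠ -((m : ℂ) + 1)) →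
      HasSum (seriesTerm k)
        (8 / (Real.pi : ℂ) * (16 / 27 : ℂ) ^ k *
          (pochhammerC 1 k ^ 2 / (pochhammerC (1 / 6) k * pochhammerC (5 / 6) k)))) ∧
    HasSum
      (fun n : ℕ =>
        (-1 / 4 : ℝ) ^ n *
          ((ascPochhammer ℝ n).eval (1 / 2) * (ascPochhammer ℝ n).eval (1 / 4) *
              (ascPochhammer ℝ n).eval (3 / 4) / (ascPochhammer ℝ n).eval 1 ^ 3) *
          (20 * (n : ℝ) + 3))
      (8 / Real.pi) := by
  refine ⟨hasSum_seriesTerm, ?_⟩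
  have h := hasSum_seriesTerm 0 fun m hm => by
    have := congrArg Complex.re hm
    simp at this
    linarith [(Nat.cast_nonneg m : (0 : ℝ) ≤ m)]
  have hv : seriesValue 0 = ((8 / Real.pi : ℝ) : ℂ) := by
    have hpi : (Real.pi : ℂ) ≠ 0 := by exact_mod_cast Real.pi_ne_zero
    rw [seriesValue_eq, add_zero, add_zero, add_zero, Gamma_sixth_mul]
    simp
    field_simp
    norm_num
  rw [hv] at h
  refine Complex.hasSum_ofReal.1 (h.congr_fun fun n => ?_)
  have hcast : ∀ x : ℝ, (((ascPochhammer ℝ n).eval x : ℝ) : ℂ) = (ascPochhammer ℂ n).eval (x : ℂ) :=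
    fun x => by
      rw [← ascPochhammer_map Complex.ofRealHom, Polynomial.eval_map]
      exact (Polynomial.eval₂_at_apply Complex.ofRealHom x).symm
  simp only [seriesTerm]
  push_cast [hcast]
  simp only [mul_zero, zero_div, add_zero]
  ring
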